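/- Let $\bar A\in\{0,\star\}^{n\times n}$ be symmetrically structured, i.e. each entry is a fixed zero or a free real parameter $\star$, the pattern is symmetric, the entries $(i,j)$ and $(j,i)$ share the same parameter, and the parameters are otherwise independent. Let $\bar B\in\{0,\star\}^{n\times m}$ be a structured matrix, i.e. each entry is a fixed zero or an independent free real parameter $\star$. A numerical realization $(\tilde A,\tilde B)$ of the pair $(\bar A,\bar B)$ is obtained by assigning arbitrary real values to all the independent free parameters; in particular $\tilde A$ is symmetric. For a target set $\mathcal T=\{i_1,\dots,i_k\}\subseteq\{1,\dots,n\}$ let $C_{\mathcal T}\in\mathbb R^{k\times n}$ be the matrix whose $\ell$-th row is the $i_\ell$-th standard unit row vector. The pair $(\bar A,\bar B)$ is called structurally target controllable with respect to $\mathcal T$ if there is a numerical realization $(\tilde A,\tilde B)$ for which the matrix $C_{\mathcal T}[\tilde B,\tilde A\tilde B,\dots,\tilde A^{n-1}\tilde B]$ has full row rank $k$. The system digraph $\mathcal D(\bar A,\bar B)$ has state vertices $\mathcal X=\{x_1,\dots,x_n\}$ and input vertices $\mathcal U=\{u_1,\dots,u_m\}$, an edge $(x_j,x_i)$ whenever $[\bar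 A]_{ij}=\star$, an edge $(u_j,x_i)$ whenever $[\bar B]_{ij}=\star$, and no other edges. Put $\mathcal X_{\mathcal T}=\{x_i: i\in\mathcal T\}$. A vertex is input-reachable if there is a directed path to it from some input vertex, and for a set $\mathcal S$ of vertices $\mathcal N(\mathcal S)=\{v\in\mathcal X\cup\mathcal U: (v,w)\text{ is an edge for some }w\in\mathcal S\}$ is its in-neighbour set. **Theorem (structural target controllability).** For every such pair $(\bar A,\bar B)$ and every $\mathcal T\subseteq\{1,\dots,n\}$, the pair $(\bar A,\bar B)$ is structurally target controllable with respect to $\mathcal T$ if and only if the following two conditions hold in $\mathcal D(\bar A,\bar B)$: 1. every vertex in $\mathcal X_{\mathcal T}$ is input-reachable; 2. $|\mathcal N(\mathcal S)|\ge|\mathcal S|$ for every $\mathcal S\subseteq\mathcal X_{\mathcal T}$. -/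

import Mathlib

/-- An entry of a structured matrix: a fixed zero or a free parameter. -/
inductive StructEntry : Type
  | zero
  | star

/-- The pattern of a structured `n × m` matrix, an element of `{0, ⋆}^{n × m}`. -/
abbrev StructuredMatrix (n m : ℕ) : Type := Matrix (Fin n) (Fin m) StructEntry

namespace StructuredMatrix

/-- A numerical realization of a structured matrix: the fixed zeros are kept, and every star is
replaced by a real number (possibly zero), independently of the others. -/
def IsRealization {n m : ℕ} (M : StructuredMatrix n m) (R : Matrix (Fin n) (Fin m) ℝ) : Prop :=
  ∀ i j, M i j = StructEntry.zero → R i j = 0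

/-- The pattern of a symmetrically structured matrix: `(i, j)` carries a star iff `(j, i)` does. -/
def IsSymmetricallyStructured {n : ℕ} (A : StructuredMatrix n n) : Prop :=
  ∀ i j, A i j = A j i

/-- A numerical realization of a symmetrically structured matrix: the fixed zeros are kept, and
every star is replaced by a real number (possibly zero), where the stars at `(i, j)` and `(j, i)`
are one and the same parameter. -/
def IsSymmRealization {n : ℕ} (A : StructuredMatrix n n) (R : Matrix (Fin n) (Fin n) ℝ) : Prop :=
  A.IsRealization R ∧ ∀ i j, R i j = R j i

end StructuredMatrix

/-- The controllability matrix `[B, A B, …, A ^ (n - 1) B]`; column `(k, j)` is the `j`-th column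
of `A ^ k * B`. -/
def controllabilityMatrix {n m : ℕ} (A : Matrix (Fin n) (Fin n) ℝ) (B : Matrix (Fin n) (Fin m) ℝ) :
    Matrix (Fin n) (Fin n × Fin m) ℝ :=
  Matrix.of fun i c => (A ^ (c.1 : ℕ) * B) i c.2

/-- The matrix `C_T` that selects the states in `T`; its rows are indexed by the elements of `T`. -/
def targetMatrix {n : ℕ} (T : Finset (Fin n)) : Matrix T (Fin n) ℝ :=
  Matrix.of fun l j => if j = (l : Fin n) then 1 else 0

/-- The target controllability matrix `C_T [B, A B, …, A ^ (n - 1) B]`. -/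
def targetControllabilityMatrix {n m : ℕ} (A : Matrix (Fin n) (Fin n) ℝ)
    (B : Matrix (Fin n) (Fin m) ℝ) (T : Finset (Fin n)) : Matrix T (Fin n × Fin m) ℝ :=
  targetMatrix T * controllabilityMatrix A B

/-- Structural target controllability of the pair `(A, B)`, where `A` is understood as a
symmetrically structured and `B` as a structured matrix: for some numerical realization of the pair
the target controllability matrix has full row rank. -/
def StructurallyTargetControllable {n m : ℕ} (A : StructuredMatrix n n) (B : StructuredMatrix n m)
    (T : Finset (Fin n)) : Prop :=
  ∃ (RA : Matrix (Fin n) (Fin n) ℝ) (RB : Matrix (Fin n) (Fin m) ℝ),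
    A.IsSymmRealization RA ∧ B.IsRealization RB ∧
      (targetControllabilityMatrix RA RB T).rank = T.card

/-- A path from `v` to `w`: a sequence of distinct vertices, consecutive ones joined by an edge. -/
def Digraph.IsPathFromTo {V : Type*} (D : Digraph V) (v w : V) (p : List V) : Prop :=
  p.Nodup ∧ p.IsChain D.Adj ∧ p.head? = some v ∧ p.getLast? = some w

/-- The in-neighbour set of a set of vertices. -/
def Digraph.inNeighbourSet {V : Type*} (D : Digraph V) (S : Set V) : Set V :=
  {v | ∃ w ∈ S, D.Adj v w}

/-- The system digraph of `(A, B)`: `Sum.inl i` is the state vertex `x_i`, `Sum.inr j` the input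
vertex `u_j`; there is an edge from `x_j` to `x_i` iff `A i j` is a star, an edge from `u_j` to
`x_i` iff `B i j` is a star, and no other edge. -/
def systemDigraph {n m : ℕ} (A : StructuredMatrix n n) (B : StructuredMatrix n m) :
    Digraph (Fin n ⊕ Fin m) where
  Adj v w :=
    match v, w with
    | Sum.inl j, Sum.inl i => A i j = StructEntry.star
    | Sum.inr j, Sum.inl i => B i j = StructEntry.star
    | _, Sum.inr _ => False

/-- A vertex of the system digraph is input-reachable if some path leads to it from an input
vertex. -/
def InputReachable {n m : ℕ} (A : StructuredMatrix n n) (B : StructuredMatrix n m)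
    (v : Fin n ⊕ Fin m) : Prop :=
  ∃ (j : Fin m) (p : List (Fin n ⊕ Fin m)), (systemDigraph A B).IsPathFromTo (Sum.inr j) v p

/-- The set of state vertices that correspond to the target set `T`. -/
def targetVertices {n : ℕ} (m : ℕ) (T : Finset (Fin n)) : Set (Fin n ⊕ Fin m) :=
  {v | ∃ i ∈ T, v = Sum.inl i}

/-! Necessity holds for every realization. A nonzero entry of `A ^ l * B` traces a path from an
input. If `S` has fewer in-neighbours than elements, some nonzero combination of the rows of `[A B]`
in `S` vanishes; it kills every `A ^ l * B`, so the target rows are dependent.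

For sufficiency, `A` and `B` are placed as blocks of one symmetric matrix `M` on states and inputs,
supported on the symmetrized digraph. It is chosen so that finitely many matrices polynomial in `M`
have maximal rank. The main tool is `eq_zero_of_rank_le_rank_zero`: where the rank is maximal, a
first-order perturbation pairs to zero between left and right kernel. It is used three times,
perturbing a single edge. (a) Maximality of the number of distinct eigenvalues makes the nonzero
eigenvalues of principal submatrices simple. (b) Maximality of Krylov ranks then shows that an
eigenvector of the `Y`-block for a nonzero eigenvalue, if orthogonal to row `k ∉ Y`, vanishes at all
neighbours of `k`. (c) Maximality of the rank of the rows in `S` excludes a relation with full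
support `S` when `S` has at least `|S|` neighbours.

Let `w`, supported on the targets, kill all `A ^ l * B`. The reachable vectors with this property
form an `A`-invariant subspace. By (b), zeros of an eigenvector with nonzero eigenvalue spread from
the inputs along paths, so the subspace contains none; since `A` is symmetric, `A w = 0`. Thus `w`,
padded by zero, is a relation among the rows of `M`, and (c) with the cardinality condition gives `w
= 0`. -/

open Matrix

/-! ### Polynomials along lines and generic properties -/

/-- A real function on a vector space whose restriction to every line is a polynomial. -/
def PolyOnLines {E : Type*} [AddCommGroup E] [Module ℝ E] (f : E → ℝ) : Prop :=
  ∀ x y, ∃ p : Polynomial ℝ, ∀ t : ℝ, f (x + t • y) = p.eval t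

namespace PolyOnLines

variable {E : Type*} [AddCommGroup E] [Module ℝ E] {f g : E → ℝ}

lemma const (c : ℝ) : PolyOnLines (fun _ : E => c) := fun _ _ => ⟨Polynomial.C c, by simp⟩

lemma linear (l : E →ₗ[ℝ] ℝ) : PolyOnLines (fun x => l x) := fun x y =>
  ⟨Polynomial.C (l x) + Polynomial.C (l y) * Polynomial.X, fun t => by simp [mul_comm t]⟩

lemma add (hf : PolyOnLines f) (hg : PolyOnLines g) : PolyOnLines (fun x => f x + g x) := by
  intro x y
  obtain ⟨p, hp⟩ := hf x y
  obtain ⟨q, hq⟩ := hg x y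
  exact ⟨p + q, by simp [hp, hq]⟩

lemma mul (hf : PolyOnLines f) (hg : PolyOnLines g) : PolyOnLines (fun x => f x * g x) := by
  intro x y
  obtain ⟨p, hp⟩ := hf x y
  obtain ⟨q, hq⟩ := hg x y
  exact ⟨p * q, by simp [hp, hq]⟩

lemma sum {ι : Type*} (s : Finset ι) {f : ι → E → ℝ} (hf : ∀ i ∈ s, PolyOnLines (f i)) :
    PolyOnLines (fun x => ∑ i ∈ s, f i x) := by
  classical
  induction s using Finset.induction_on with
  | empty => simpa using const 0
  | insert a s ha ih =>
    simp only [Finset.sum_insert ha]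
    exact (hf a (by simp)).add (ih fun i hi => hf i (by simp [hi]))

lemma prod {ι : Type*} (s : Finset ι) {f : ι → E → ℝ} (hf : ∀ i ∈ s, PolyOnLines (f i)) :
    PolyOnLines (fun x => ∏ i ∈ s, f i x) := by
  classical
  induction s using Finset.induction_on with
  | empty => simpa using const 1
  | insert a s ha ih =>
    simp only [Finset.prod_insert ha]
    exact (hf a (by simp)).mul (ih fun i hi => hf i (by simp [hi]))

lemma matrix_mul {α β γ : Type*} [Fintype β] {F : E → Matrix α β ℝ} {G : E → Matrix β γ ℝ}
    (hF : ∀ i j, PolyOnLines fun x => F x i j) (hG : ∀ i j, PolyOnLines fun x => G x i j)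
    (i : α) (j : γ) : PolyOnLines fun x => (F x * G x) i j := by
  simp only [Matrix.mul_apply]
  exact sum _ fun k _ => (hF i k).mul (hG k j)

lemma matrix_pow {α : Type*} [Fintype α] [DecidableEq α] {F : E → Matrix α α ℝ}
    (hF : ∀ i j, PolyOnLines fun x => F x i j) (k : ℕ) (i j : α) :
    PolyOnLines fun x => (F x ^ k) i j := by
  induction k generalizing i j with
  | zero => simpa using const _
  | succ k ih => simpa only [pow_succ] using matrix_mul ih hF i j

lemma det {α : Type*} [Fintype α] [DecidableEq α] {F : E → Matrix α α ℝ}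
    (hF : ∀ i j, PolyOnLines fun x => F x i j) : PolyOnLines fun x => (F x).det := by
  simp only [Matrix.det_apply']
  exact sum _ fun σ _ => (const _).mul (prod _ fun i _ => hF _ _)

end PolyOnLines

/-- A property that holds on the nonvanishing locus of a function that is polynomial on lines and
does not vanish identically on `L`. -/
def GenericOn {E : Type*} [AddCommGroup E] [Module ℝ E] (L : Submodule ℝ E) (P : E → Prop) :
    Prop :=
  ∃ f : E → ℝ, PolyOnLines f ∧ (∃ x ∈ L, f x ≠ 0) ∧ ∀ x ∈ L, f x ≠ 0 → P x

namespace GenericOn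

variable {E : Type*} [AddCommGroup E] [Module ℝ E] {L : Submodule ℝ E} {P Q : E → Prop}

lemma exists_mem (h : GenericOn L P) : ∃ x ∈ L, P x := by
  obtain ⟨f, -, ⟨x, hx, hfx⟩, h⟩ := h
  exact ⟨x, hx, h x hx hfx⟩

/-- On the line joining a nonzero of `f` to a nonzero of `g`, both restrict to nonzero polynomials
in one variable, whose product is nonzero. This is why polynomiality on lines suffices. -/
lemma and (hP : GenericOn L P) (hQ : GenericOn L Q) : GenericOn L fun x => P x ∧ Q x := by
  obtain ⟨f, hf, ⟨x, hx, hfx⟩, hP⟩ := hP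
  obtain ⟨g, hg, ⟨y, hy, hgy⟩, hQ⟩ := hQ
  refine ⟨fun z => f z * g z, hf.mul hg, ?_, fun z hz h =>
    ⟨hP z hz (left_ne_zero_of_mul h), hQ z hz (right_ne_zero_of_mul h)⟩⟩
  obtain ⟨p, hp⟩ := hf x (y - x)
  obtain ⟨q, hq⟩ := hg x (y - x)
  have hp0 : p ≠ 0 := by
    rintro rfl
    exact hfx (by simpa using hp 0)
  have hq0 : q ≠ 0 := by
    rintro rfl
    exact hgy (by simpa using hq 1)
  by_contra! hcon
  refine mul_ne_zero hp0 hq0 (Polynomial.funext fun t => ?_)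
  have := hcon (x + t • (y - x)) (L.add_mem hx (L.smul_mem t (L.sub_mem hy hx)))
  simpa [hp, hq] using this

lemma finset_forall {ι : Type*} (s : Finset ι) {P : ι → E → Prop}
    (h : ∀ i ∈ s, GenericOn L (P i)) : GenericOn L fun x => ∀ i ∈ s, P i x := by
  classical
  induction s using Finset.induction_on with
  | empty => exact ⟨fun _ => 1, .const 1, ⟨0, L.zero_mem, one_ne_zero⟩, by simp⟩
  | insert a s ha ih =>
    simp only [Finset.forall_mem_insert]
    exact (h a (by simp)).and (ih fun i hi => h i (by simp [hi]))

lemma fintype_forall {ι : Type*} [Fintype ι] {P : ι → E → Prop}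
    (h : ∀ i, GenericOn L (P i)) : GenericOn L fun x => ∀ i, P i x := by
  simpa using finset_forall Finset.univ fun i _ => h i

end GenericOn

/-! ### Maximal rank and its first-order consequence -/

lemma Matrix.exists_mul_mul_eq_one {α β : Type*} [Fintype α] [Fintype β] [DecidableEq α]
    [DecidableEq β] (F : Matrix α β ℝ) :
    ∃ (R : Matrix (Fin F.rank) α ℝ) (S : Matrix β (Fin F.rank) ℝ), R * F * S = 1 := by
  let e : (Fin F.rank → ℝ) ≃ₗ[ℝ] LinearMap.range F.mulVecLin :=
    LinearEquiv.ofFinrankEq _ _ (by rw [Module.finrank_fin_fun, Matrix.rank])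
  obtain ⟨g, hg⟩ := F.mulVecLin.rangeRestrict.exists_rightInverse_of_surjective
    (LinearMap.range_rangeRestrict _)
  obtain ⟨r, hr⟩ := ((LinearMap.range F.mulVecLin).subtype ∘ₗ e.toLinearMap).exists_leftInverse_of_injective
    (LinearMap.ker_eq_bot.2 (Subtype.val_injective.comp e.injective))
  refine ⟨LinearMap.toMatrix' r, LinearMap.toMatrix' (g ∘ₗ e.toLinearMap), ?_⟩
  apply Matrix.toLin'.injective
  ext1 i
  simp only [Matrix.toLin'_mul, Matrix.toLin'_toMatrix', Matrix.toLin'_one]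
  ext1
  have h1 := congrArg Subtype.val (LinearMap.congr_fun hg (e (LinearMap.single ℝ (fun _ => ℝ) i 1)))
  have h2 := LinearMap.congr_fun hr (LinearMap.single ℝ (fun _ => ℝ) i 1)
  simp only [LinearMap.comp_apply, LinearMap.codRestrict_apply, LinearMap.id_apply,
    LinearMap.rangeRestrict, Submodule.subtype_apply, LinearEquiv.coe_coe, Matrix.toLin'_apply,
    Matrix.mulVecLin_apply] at h1 h2 ⊢
  rw [h1, h2]

lemma Matrix.card_le_rank_of_det_ne_zero {α β γ : Type*} [Fintype α] [Fintype β] [Fintype γ]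
    [DecidableEq γ] {F : Matrix α β ℝ} {R : Matrix γ α ℝ} {S : Matrix β γ ℝ}
    (h : (R * F * S).det ≠ 0) : Fintype.card γ ≤ F.rank := by
  rw [← Matrix.rank_of_isUnit (R * F * S) ((Matrix.isUnit_iff_isUnit_det _).2 h.isUnit)]
  exact ((R * F).rank_mul_le_left S).trans (R.rank_mul_le_right F)

/-- The rank of a matrix with polynomial entries is generically maximal. -/
lemma genericOn_rank_le {E : Type*} [AddCommGroup E] [Module ℝ E] (L : Submodule ℝ E)
    {α β : Type*} [Fintype α] [Fintype β] {F : E → Matrix α β ℝ}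
    (hF : ∀ i j, PolyOnLines fun x => F x i j) :
    GenericOn L fun x => ∀ y ∈ L, (F y).rank ≤ (F x).rank := by
  classical
  obtain ⟨x, hx, hmax⟩ : ∃ x ∈ L, ∀ y ∈ L, (F y).rank ≤ (F x).rank := by
    have hfin : ((fun x => (F x).rank) '' (L : Set E)).Finite :=
      (Set.finite_Iic (Fintype.card α)).subset (by
        rintro _ ⟨x, -, rfl⟩
        exact (F x).rank_le_card_height)
    obtain ⟨x, hx, h⟩ := hfin.exists_maximalFor' (fun x => (F x).rank) (L : Set E) ⟨0, L.zero_mem⟩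
    exact ⟨x, hx, fun y hy => (le_total _ _).elim id fun h' => h hy h'⟩
  obtain ⟨R, S, hRS⟩ := (F x).exists_mul_mul_eq_one
  refine ⟨fun z => (R * F z * S).det, PolyOnLines.det (PolyOnLines.matrix_mul
    (PolyOnLines.matrix_mul (fun _ _ => .const _) hF) fun _ _ => .const _),
    ⟨x, hx, by simp [hRS]⟩, fun z _ hz y hy => (hmax y hy).trans ?_⟩
  simpa using Matrix.card_le_rank_of_det_ne_zero hz

/-- If the rank of a polynomial family of matrices is maximal at `0`, then its derivative at `0`
vanishes between the left and the right kernel. -/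
lemma eq_zero_of_rank_le_rank_zero {α β : Type*} [Fintype α] [Fintype β]
    {F : ℝ → Matrix α β ℝ} (hF : ∀ i j, ∃ p : Polynomial ℝ, ∀ t, F t i j = p.eval t)
    (hrank : ∀ t, (F t).rank ≤ (F 0).rank) {v : α → ℝ} {u : β → ℝ} (hv : v ᵥ* F 0 = 0)
    (hu : F 0 *ᵥ u = 0) {g : ℝ → ℝ} (hg : ContinuousAt g 0)
    (h : ∀ t, v ⬝ᵥ F t *ᵥ u = t * g t) : g 0 = 0 := by
  classical
  obtain ⟨r, hr, R, S, hRS⟩ : ∃ r, r = (F 0).rank ∧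
      ∃ (R : Matrix (Fin r) α ℝ) (S : Matrix β (Fin r) ℝ), R * F 0 * S = 1 :=
    ⟨_, rfl, (F 0).exists_mul_mul_eq_one⟩
  choose P hP using hF
  let R' : Matrix (Fin r ⊕ Unit) α ℝ := Matrix.fromRows R (Matrix.replicateRow Unit v)
  let S' : Matrix β (Fin r ⊕ Unit) ℝ := Matrix.fromCols S (Matrix.replicateCol Unit u)
  -- Bordering by `v` and `u` gives size `r + 1`, which exceeds the rank of every `F t`.
  have hdet : ∀ t, (R' * F t * S').det = 0 := by
    intro t
    by_contra hne
    have := (Matrix.card_le_rank_of_det_ne_zero hne).trans (hrank t)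
    simp [← hr] at this
  -- the last row of the bordered matrix is divisible by `t`
  let q : Fin r ⊕ Unit → Polynomial ℝ := fun s =>
    ∑ j, (∑ i, Polynomial.C (v i) * P i j) * Polynomial.C (S' j s)
  have hq : ∀ s t, (q s).eval t = (R' * F t * S') (Sum.inr ()) s := by
    intro s t
    simp [q, R', Matrix.mul_apply, Polynomial.eval_finsetSum, hP]
  have hq0 : ∀ s, Polynomial.X ∣ q s := by
    intro s
    rw [Polynomial.X_dvd_iff, Polynomial.coeff_zero_eq_eval_zero, hq]
    have : ∀ j, (R' * F 0) (Sum.inr ()) j = 0 := fun j => congrFun hv j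
    rw [Matrix.mul_apply]
    simp [this]
  choose k hk using hq0
  let N : ℝ → Matrix (Fin r ⊕ Unit) (Fin r ⊕ Unit) ℝ := fun t =>
    (R' * F t * S').updateRow (Sum.inr ()) fun s => (k s).eval t
  have hN : ∀ t, t * (N t).det = 0 := by
    intro t
    rw [← hdet t, ← Matrix.det_updateRow_smul]
    congr 1
    ext a s
    rcases a with a | a
    · simp [Matrix.updateRow_apply]
    · simp [← hq, hk, Matrix.updateRow_apply]
  have hFc : Continuous F := by
    refine continuous_matrix fun i j => ?_
    simp only [hP]
    exact (P i j).continuous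
  have hNc : Continuous fun t => (N t).det := by
    refine Continuous.matrix_det (Continuous.matrix_updateRow _ ?_ ?_)
    · exact (continuous_const.matrix_mul hFc).matrix_mul continuous_const
    · exact continuous_pi fun s => (k s).continuous
  have eq_zero : ∀ {φ : ℝ → ℝ}, ContinuousAt φ 0 → (∀ t ≠ 0, φ t = 0) → φ 0 = 0 := by
    intro φ hφ h0
    have h1 : Filter.Tendsto φ (nhdsWithin 0 {0}ᶜ) (nhds (φ 0)) := hφ.tendsto.mono_left
      nhdsWithin_le_nhds
    have h2 : Filter.Tendsto φ (nhdsWithin 0 {0}ᶜ) (nhds 0) := by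
      refine tendsto_const_nhds.congr' ?_
      filter_upwards [self_mem_nhdsWithin] with t ht
      exact (h0 t ht).symm
    exact tendsto_nhds_unique h1 h2
  have hN0 : (N 0).det = 0 := eq_zero hNc.continuousAt fun t ht =>
    (mul_eq_zero.1 (hN t)).resolve_left ht
  have hg0 : (k (Sum.inr ())).eval 0 = g 0 := by
    refine sub_eq_zero.1 (eq_zero (φ := fun t => (k (Sum.inr ())).eval t - g t)
      ((k (Sum.inr ())).continuous.continuousAt.sub hg) fun t ht => ?_)
    have h1 := hq (Sum.inr ()) t
    have h2 : (R' * F t * S') (Sum.inr ()) (Sum.inr ()) = t * g t := by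
      rw [← h t, Matrix.dotProduct_mulVec]
      rfl
    rw [h2, hk, Polynomial.eval_mul, Polynomial.eval_X] at h1
    exact sub_eq_zero.2 (mul_left_cancel₀ ht h1)
  -- After division of the last row by `t`, the matrix at `0` is block triangular because `F 0 *ᵥ u
  -- = 0`; its determinant is `1 * g 0`.
  have hblock : N 0 = Matrix.fromBlocks (R * F 0 * S) 0
      (Matrix.of fun _ s => (k (Sum.inl s)).eval 0) (Matrix.of fun _ _ => g 0) := by
    ext a s
    rcases a with a | a <;> rcases s with s | s
    · simp [N, R', S', Matrix.fromRows_mul, Matrix.mul_fromCols, Matrix.updateRow_apply]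
    · have : ((R * F 0) *ᵥ u) a = 0 := by rw [← Matrix.mulVec_mulVec, hu]; simp
      simp only [N, R', S', Matrix.fromRows_mul, Matrix.mul_fromCols]
      simpa [Matrix.updateRow_apply, ← Matrix.replicateCol_mulVec] using this
    · simp [N]
    · simp [N, hg0]
  rw [hblock, Matrix.det_fromBlocks_zero₁₂, hRS] at hN0
  simpa using hN0

/-! ### Symmetric matrices on a pattern and their polynomials -/

section SymmetricPatterns

variable {V : Type*} [Fintype V] [DecidableEq V]

/-- The real symmetric matrices supported on a given pattern. -/
def symmPattern (adj : V → V → Prop) : Submodule ℝ (Matrix V V ℝ) where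
  carrier := {M | (∀ i j, M i j = M j i) ∧ ∀ i j, ¬ adj i j → M i j = 0}
  add_mem' := by
    rintro M N ⟨hM, hM'⟩ ⟨hN, hN'⟩
    exact ⟨fun i j => by simp [hM i j, hN i j], fun i j h => by simp [hM' i j h, hN' i j h]⟩
  zero_mem' := by simp
  smul_mem' := by
    rintro c M ⟨hM, hM'⟩
    exact ⟨fun i j => by simp [hM i j], fun i j h => by simp [hM' i j h]⟩

/-- The symmetric matrix unit attached to the pair `i, j`. -/
def edgeMatrix (i j : V) : Matrix V V ℝ := Matrix.single i j 1 + Matrix.single j i 1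

omit [Fintype V] in
lemma edgeMatrix_mem_symmPattern {adj : V → V → Prop} (hadj : ∀ i j, adj i j → adj j i) {i j : V}
    (h : adj i j) : edgeMatrix i j ∈ symmPattern adj := by
  refine ⟨fun a b => ?_, fun a b hab => ?_⟩
  · simp only [edgeMatrix, Matrix.add_apply, Matrix.single_apply]
    simp only [and_comm, add_comm]
  · have h1 : ¬ (i = a ∧ j = b) := by rintro ⟨rfl, rfl⟩; exact hab h
    have h2 : ¬ (j = a ∧ i = b) := by rintro ⟨rfl, rfl⟩; exact hab (hadj _ _ h)
    simp [edgeMatrix, h1, h2]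

lemma dotProduct_edgeMatrix_mulVec (i j : V) (v u : V → ℝ) :
    v ⬝ᵥ edgeMatrix i j *ᵥ u = v i * u j + v j * u i := by
  simp only [edgeMatrix, Matrix.add_mulVec, Matrix.single_mulVec, dotProduct_add, one_mul]
  change v ⬝ᵥ Pi.single i (u j) + v ⬝ᵥ Pi.single j (u i) = _
  simp

/-- The principal submatrix on `Y`, padded with zeros. -/
def principalPart (M : Matrix V V ℝ) (Y : Finset V) : Matrix V V ℝ :=
  Matrix.of fun i j => if i ∈ Y ∧ j ∈ Y then M i j else 0

omit [Fintype V] in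
lemma principalPart_add_smul (M N : Matrix V V ℝ) (Y : Finset V) (t : ℝ) :
    principalPart (M + t • N) Y = principalPart M Y + t • principalPart N Y := by
  ext i j
  by_cases h : i ∈ Y ∧ j ∈ Y <;> simp [principalPart, h]

omit [Fintype V] in
lemma principalPart_transpose {adj : V → V → Prop} {M : Matrix V V ℝ} (hM : M ∈ symmPattern adj)
    (Y : Finset V) : (principalPart M Y)ᵀ = principalPart M Y := by
  ext i j
  simp [principalPart, hM.1 j i, and_comm]

omit [Fintype V] in
lemma polyOnLines_principalPart (Y : Finset V) (i j : V) :
    PolyOnLines fun M : Matrix V V ℝ => principalPart M Y i j := by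
  by_cases h : i ∈ Y ∧ j ∈ Y
  · simpa [principalPart, h] using PolyOnLines.linear (Matrix.entryLinearMap ℝ ℝ i j)
  · simpa [principalPart, h] using PolyOnLines.const 0

lemma eq_zero_of_principalPart_mulVec {M : Matrix V V ℝ} {Y : Finset V} {w : V → ℝ} {μ : ℝ}
    (hμ : μ ≠ 0) (hw : principalPart M Y *ᵥ w = μ • w) {i : V} (hi : i ∉ Y) : w i = 0 := by
  have := congrFun hw i
  simpa [Matrix.mulVec, dotProduct, principalPart, hi, hμ, eq_comm] using this

lemma dotProduct_principalPart_mulVec {M : Matrix V V ℝ} {Y : Finset V} {u v : V → ℝ}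
    (hu : ∀ i ∉ Y, u i = 0) (hv : ∀ i ∉ Y, v i = 0) :
    v ⬝ᵥ principalPart M Y *ᵥ u = v ⬝ᵥ M *ᵥ u := by
  simp only [dotProduct, Matrix.mulVec, Finset.mul_sum]
  refine Finset.sum_congr rfl fun i _ => Finset.sum_congr rfl fun j _ => ?_
  by_cases hi : i ∈ Y
  · by_cases hj : j ∈ Y
    · simp [principalPart, hi, hj]
    · simp [hu j hj]
  · simp [hv i hi]

lemma aeval_mulVec_of_eigenvector {A : Matrix V V ℝ} {w : V → ℝ} {μ : ℝ} (h : A *ᵥ w = μ • w)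
    (p : Polynomial ℝ) : Polynomial.aeval A p *ᵥ w = p.eval μ • w := by
  induction p using Polynomial.induction_on' with
  | add p q hp hq => simp [Matrix.add_mulVec, hp, hq, add_smul]
  | monomial n a =>
    have hpow : ∀ n : ℕ, A ^ n *ᵥ w = μ ^ n • w := by
      intro n
      induction n with
      | zero => simp
      | succ n ih => rw [pow_succ, ← Matrix.mulVec_mulVec, h, Matrix.mulVec_smul, ih, smul_smul,
          pow_succ']
    rw [Polynomial.aeval_monomial, Polynomial.eval_monomial, ← Algebra.smul_def,
      Matrix.smul_mulVec, hpow, smul_smul]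

lemma sum_coeff_mul_pow_apply (A : Matrix V V ℝ) {p : Polynomial ℝ}
    {N : ℕ} (hp : p.natDegree < N) (i j : V) :
    ∑ l : Fin N, (A ^ (l : ℕ)) i j * p.coeff l = Polynomial.aeval A p i j := by
  rw [Polynomial.aeval_eq_sum_range' hp, Matrix.sum_apply, Finset.sum_range]
  exact Finset.sum_congr rfl fun l _ => by simp [mul_comm]

/-- By the spectral theorem there is a basis of eigenvectors, each killed by its own factor;
repeated eigenvalues are listed once. -/
lemma exists_aeval_prod_eq_zero {A : Matrix V V ℝ} (hA : Aᵀ = A) :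
    ∃ s : Finset ℝ, s.card ≤ Fintype.card V ∧
      Polynomial.aeval A (∏ μ ∈ s, (Polynomial.X - Polynomial.C μ)) = 0 := by
  have hA' : A.IsHermitian := by
    rw [Matrix.IsHermitian, Matrix.conjTranspose_eq_transpose_of_trivial, hA]
  refine ⟨Finset.univ.image hA'.eigenvalues, Finset.card_image_le, ?_⟩
  set p := ∏ μ ∈ Finset.univ.image hA'.eigenvalues, (Polynomial.X - Polynomial.C μ)
  apply Matrix.toLin'.injective
  rw [map_zero]
  refine (hA'.eigenvectorBasis.toBasis.map (WithLp.linearEquiv 2 ℝ (V → ℝ))).ext fun j => ?_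
  have h := aeval_mulVec_of_eigenvector (hA'.mulVec_eigenvectorBasis j) p
  have hp : p.eval (hA'.eigenvalues j) = 0 := by
    rw [Polynomial.eval_prod]
    exact Finset.prod_eq_zero (Finset.mem_image_of_mem _ (Finset.mem_univ j)) (by simp)
  rw [hp, zero_smul] at h
  simpa using h

/-- A polynomial in `A` which annihilates all eigenspaces of a symmetric matrix but one. -/
lemma exists_separating_polynomial {A : Matrix V V ℝ} (hA : Aᵀ = A) {w : V → ℝ} (hw : w ≠ 0)
    {μ : ℝ} (h : A *ᵥ w = μ • w) :
    ∃ q : Polynomial ℝ, q.natDegree < Fintype.card V ∧ q.eval μ ≠ 0 ∧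
      Polynomial.aeval A ((Polynomial.X - Polynomial.C μ) * q) = 0 := by
  obtain ⟨s, hs, hs0⟩ := exists_aeval_prod_eq_zero hA
  have hμ : μ ∈ s := by
    have h1 := aeval_mulVec_of_eigenvector h (∏ μ ∈ s, (Polynomial.X - Polynomial.C μ))
    rw [hs0, Matrix.zero_mulVec, eq_comm, smul_eq_zero, or_iff_left hw, Polynomial.eval_prod,
      Finset.prod_eq_zero_iff] at h1
    obtain ⟨a, ha, h1⟩ := h1
    have : μ = a := by simpa [sub_eq_zero] using h1
    rwa [this]
  refine ⟨∏ ν ∈ s.erase μ, (Polynomial.X - Polynomial.C ν), ?_, ?_, ?_⟩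
  · rw [Polynomial.natDegree_prod_of_monic _ _ fun _ _ => Polynomial.monic_X_sub_C _]
    simp only [Polynomial.natDegree_X_sub_C, Finset.sum_const, smul_eq_mul, mul_one]
    exact (Finset.card_erase_lt_of_mem hμ).trans_le hs
  · rw [Polynomial.eval_prod]
    refine Finset.prod_ne_zero_iff.2 fun ν hν => ?_
    simpa [sub_eq_zero] using (Finset.ne_of_mem_erase hν).symm
  · rwa [Finset.mul_prod_erase s (fun ν => Polynomial.X - Polynomial.C ν) hμ]

/-- The powers of `A`, flattened into the columns of a matrix. -/
def powerMatrix (A : Matrix V V ℝ) : Matrix (V × V) (Fin (Fintype.card V + 1)) ℝ :=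
  Matrix.of fun ij l => (A ^ (l : ℕ)) ij.1 ij.2

/-- The columns `A ^ l * a`. -/
def krylovMatrix (A : Matrix V V ℝ) (a : V → ℝ) : Matrix V (Fin (Fintype.card V + 1)) ℝ :=
  Matrix.of fun i l => (A ^ (l : ℕ) *ᵥ a) i

/-- Annihilating polynomials of degree at most `|V|` become right kernel vectors, which is why there
are `|V| + 1` columns. For symmetric `A` the rank is the degree of the minimal polynomial, the
number of distinct eigenvalues. -/
lemma powerMatrix_mulVec_coeff (A : Matrix V V ℝ) {p : Polynomial ℝ}
    (hp : p.natDegree < Fintype.card V + 1) (ij : V × V) :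
    (powerMatrix A *ᵥ fun l => p.coeff l) ij = Polynomial.aeval A p ij.1 ij.2 :=
  sum_coeff_mul_pow_apply A hp ij.1 ij.2

lemma krylovMatrix_mulVec_coeff (A : Matrix V V ℝ) (a : V → ℝ) {p : Polynomial ℝ}
    (hp : p.natDegree < Fintype.card V + 1) :
    (krylovMatrix A a *ᵥ fun l => p.coeff l) = Polynomial.aeval A p *ᵥ a := by
  ext i
  simp only [Matrix.mulVec, dotProduct, krylovMatrix, Matrix.of_apply,
    ← sum_coeff_mul_pow_apply A hp, Finset.sum_mul]
  rw [Finset.sum_comm]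
  exact Finset.sum_congr rfl fun _ _ => Finset.sum_congr rfl fun _ _ => by ring

end SymmetricPatterns

/-! ### Eigenvectors and row relations at points of maximal rank -/

section GenericSpectrum

variable {V : Type*} [Fintype V] [DecidableEq V] {adj : V → V → Prop}

lemma genericOn_rank_powerMatrix (L : Submodule ℝ (Matrix V V ℝ)) (Y : Finset V) :
    GenericOn L fun M => ∀ N ∈ L,
      (powerMatrix (principalPart N Y)).rank ≤ (powerMatrix (principalPart M Y)).rank :=
  genericOn_rank_le L (F := fun M => powerMatrix (principalPart M Y)) fun ij l =>
    PolyOnLines.matrix_pow (polyOnLines_principalPart Y) l ij.1 ij.2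

lemma genericOn_rank_krylovMatrix (L : Submodule ℝ (Matrix V V ℝ)) (Y : Finset V) (k : V) :
    GenericOn L fun M => ∀ N ∈ L, (krylovMatrix (principalPart N Y) (N k)).rank ≤
      (krylovMatrix (principalPart M Y) (M k)).rank := by
  refine genericOn_rank_le L (F := fun M => krylovMatrix (principalPart M Y) (M k)) fun i l => ?_
  simp only [krylovMatrix, Matrix.of_apply, Matrix.mulVec, dotProduct]
  exact PolyOnLines.sum _ fun j _ =>
    (PolyOnLines.matrix_pow (polyOnLines_principalPart Y) l i j).mul
      (PolyOnLines.linear (Matrix.entryLinearMap ℝ ℝ k j))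

/-- Where the number of distinct eigenvalues is maximal, no perturbation splits an eigenvalue. -/
lemma perturbation_eq_zero_of_rank_powerMatrix_max {A E : Matrix V V ℝ} (hA : Aᵀ = A)
    (hrank : ∀ t : ℝ, (powerMatrix (A + t • E)).rank ≤ (powerMatrix A).rank) {μ α β : ℝ}
    {u u' v v' : V → ℝ} (hu0 : u ≠ 0)
    (hu : A *ᵥ u = μ • u) (hu' : A *ᵥ u' = μ • u') (hv : A *ᵥ v = μ • v) (hv' : A *ᵥ v' = μ • v')
    (h : α * (u ⬝ᵥ u') + β * (v ⬝ᵥ v') = 0) :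
    α * (u ⬝ᵥ E *ᵥ u') + β * (v ⬝ᵥ E *ᵥ v') = 0 := by
  obtain ⟨q, hqdeg, hqμ, hq⟩ := exists_separating_polynomial hA hu0 hu
  set p := (Polynomial.X - Polynomial.C μ) * q with hp
  have hpdeg : p.natDegree < Fintype.card V + 1 := by
    refine (Polynomial.natDegree_mul_le).trans_lt ?_
    rw [Polynomial.natDegree_X_sub_C]
    omega
  -- Pairing `x` with `A ^ l` gives `μ ^ l` times the vanishing combination of dot products, so `x`
  -- is in the left kernel of `powerMatrix A`; the coefficients of `p` are in the right kernel.
  let x : V × V → ℝ := fun ij => α * (u ij.1 * u' ij.2) + β * (v ij.1 * v' ij.2)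
  have hx : ∀ B : Matrix V V ℝ, ∑ ij : V × V, x ij * B ij.1 ij.2 =
      α * (u ⬝ᵥ B *ᵥ u') + β * (v ⬝ᵥ B *ᵥ v') := by
    intro B
    simp only [x, Fintype.sum_prod_type, dotProduct, Matrix.mulVec, Finset.mul_sum, add_mul,
      Finset.sum_add_distrib]
    congr 1 <;> exact Finset.sum_congr rfl fun _ _ => Finset.sum_congr rfl fun _ _ => by ring
  have hpow : ∀ (l : ℕ) {w : V → ℝ}, A *ᵥ w = μ • w → A ^ l *ᵥ w = μ ^ l • w := by
    intro l w hw
    simpa using aeval_mulVec_of_eigenvector hw (Polynomial.X ^ l)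
  -- The left eigenvector turns the factor `A + t • E - μ` into `t • E`, so exactly one `t` splits
  -- off; at `t = 0` the cofactor `q` acts on `w'` as `q.eval μ`.
  have hfac : ∀ (t : ℝ) {w w' : V → ℝ}, A *ᵥ w = μ • w →
      w ⬝ᵥ Polynomial.aeval (A + t • E) p *ᵥ w' =
        t * (w ⬝ᵥ E *ᵥ Polynomial.aeval (A + t • E) q *ᵥ w') := by
    intro t w w' hw
    have hw2 : w ᵥ* A = μ • w := by rw [← hA, Matrix.vecMul_transpose, hw]
    have hfirst : w ᵥ* Polynomial.aeval (A + t • E) (Polynomial.X - Polynomial.C μ) =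
        t • (w ᵥ* E) := by
      rw [map_sub, Polynomial.aeval_X, Polynomial.aeval_C, Matrix.vecMul_sub, Matrix.vecMul_add,
        Matrix.vecMul_smul, hw2, Algebra.algebraMap_eq_smul_one, Matrix.vecMul_smul,
        Matrix.vecMul_one]
      abel
    rw [hp, map_mul, Matrix.dotProduct_mulVec, ← Matrix.vecMul_vecMul, hfirst, Matrix.smul_vecMul,
      smul_dotProduct, ← Matrix.dotProduct_mulVec, ← Matrix.dotProduct_mulVec, smul_eq_mul]
  let g : ℝ → ℝ := fun t => α * (u ⬝ᵥ E *ᵥ Polynomial.aeval (A + t • E) q *ᵥ u') +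
    β * (v ⬝ᵥ E *ᵥ Polynomial.aeval (A + t • E) q *ᵥ v')
  have hgc : Continuous g := by
    have hc : Continuous fun t : ℝ => Polynomial.aeval (A + t • E) q := by
      simp only [Polynomial.aeval_eq_sum_range]
      fun_prop
    have hc' : ∀ w : V → ℝ,
        Continuous fun t : ℝ => E *ᵥ Polynomial.aeval (A + t • E) q *ᵥ w := fun w =>
      continuous_const.matrix_mulVec (hc.matrix_mulVec continuous_const)
    exact (continuous_const.mul (continuous_const.dotProduct (hc' u'))).add
      (continuous_const.mul (continuous_const.dotProduct (hc' v')))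
  have hg0 : g 0 = 0 := by
    refine eq_zero_of_rank_le_rank_zero (F := fun t : ℝ => powerMatrix (A + t • E)) ?_
      (by simpa using hrank) (v := x) (u := fun l => p.coeff l) ?_ ?_ hgc.continuousAt ?_
    · exact fun ij l => PolyOnLines.matrix_pow
        (fun i j => PolyOnLines.linear (Matrix.entryLinearMap ℝ ℝ i j)) l ij.1 ij.2 A E
    · ext l
      have := hx (A ^ (l : ℕ))
      rw [hpow l hu', hpow l hv', dotProduct_smul, dotProduct_smul] at this
      simp only [Matrix.vecMul, dotProduct, powerMatrix, Matrix.of_apply, zero_smul, add_zero,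
        Pi.zero_apply]
      rw [this]
      simp only [smul_eq_mul]
      linear_combination μ ^ (l : ℕ) * h
    · ext ij
      simp [powerMatrix_mulVec_coeff _ hpdeg, hq]
    · intro t
      have : (powerMatrix (A + t • E) *ᵥ fun l => p.coeff l) =
          fun ij => Polynomial.aeval (A + t • E) p ij.1 ij.2 :=
        funext fun ij => powerMatrix_mulVec_coeff _ hpdeg ij
      rw [this]
      change ∑ ij : V × V, x ij * _ = _
      rw [hx, hfac t hu, hfac t hv]
      ring
  simp only [g, zero_smul, add_zero, aeval_mulVec_of_eigenvector hu',
    aeval_mulVec_of_eigenvector hv', Matrix.mulVec_smul, dotProduct_smul, smul_eq_mul] at hg0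
  refine (mul_eq_zero.1 (?_ : q.eval μ * _ = 0)).resolve_left hqμ
  linear_combination hg0

/-- Generically, the nonzero eigenvalues of a symmetrically structured matrix are simple. -/
lemma eigenvalue_simple_of_rank_powerMatrix_max (hadj : ∀ i j, adj i j → adj j i)
    {M : Matrix V V ℝ} (hM : M ∈ symmPattern adj) {Y : Finset V}
    (hrank : ∀ N ∈ symmPattern adj,
      (powerMatrix (principalPart N Y)).rank ≤ (powerMatrix (principalPart M Y)).rank)
    {μ : ℝ} (hμ : μ ≠ 0) {u v : V → ℝ} (hu : principalPart M Y *ᵥ u = μ • u)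
    (hv : principalPart M Y *ᵥ v = μ • v) (huv : u ⬝ᵥ v = 0) : u = 0 ∨ v = 0 := by
  by_contra! hne
  have hu0 := fun i hi => eq_zero_of_principalPart_mulVec hμ hu (i := i) hi
  have hv0 := fun i hi => eq_zero_of_principalPart_mulVec hμ hv (i := i) hi
  have huu : 0 < u ⬝ᵥ u := by
    simpa using Matrix.dotProduct_star_self_pos_iff.2 hne.1
  have hvv : 0 < v ⬝ᵥ v := by
    simpa using Matrix.dotProduct_star_self_pos_iff.2 hne.2
  -- No edge perturbation splits `μ`, so its compression to the span of `u` and `v` is scalar: the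
  -- off-diagonal entry vanishes and the normalized diagonal entries agree. Together these equate a
  -- nonnegative multiple of a square with a nonpositive one.
  have key : ∀ i j, adj i j → u i * u j = 0 := by
    intro i j hij
    have hr : ∀ t : ℝ, (powerMatrix (principalPart M Y + t • principalPart (edgeMatrix i j) Y)).rank
        ≤ (powerMatrix (principalPart M Y)).rank := by
      intro t
      rw [← principalPart_add_smul]
      exact hrank _ (Submodule.add_mem _ hM
        (Submodule.smul_mem _ t (edgeMatrix_mem_symmPattern hadj hij)))
    have hT := principalPart_transpose hM Y
    have h1 := perturbation_eq_zero_of_rank_powerMatrix_max hT hr (α := 1) (β := 0) hne.1 hu hv hu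
      hu (by simp [huv])
    have h2 := perturbation_eq_zero_of_rank_powerMatrix_max hT hr (α := v ⬝ᵥ v)
      (β := - (u ⬝ᵥ u)) hne.1 hu hu hv hv (by ring)
    rw [dotProduct_principalPart_mulVec hv0 hu0, dotProduct_principalPart_mulVec hu0 hu0,
      dotProduct_edgeMatrix_mulVec, dotProduct_edgeMatrix_mulVec] at h1
    rw [dotProduct_principalPart_mulVec hv0 hv0, dotProduct_principalPart_mulVec hu0 hu0,
      dotProduct_edgeMatrix_mulVec, dotProduct_edgeMatrix_mulVec] at h2
    have h3 : v ⬝ᵥ v * (u i * u j) = u ⬝ᵥ u * (v i * v j) := by linarith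
    have h4 : u i * v j = - (u j * v i) := by linarith
    have h5 : v ⬝ᵥ v * (u i * u j) ^ 2 = - (u ⬝ᵥ u * (u j * v i) ^ 2) := by
      calc v ⬝ᵥ v * (u i * u j) ^ 2 = (v ⬝ᵥ v * (u i * u j)) * (u i * u j) := by ring
        _ = u ⬝ᵥ u * ((u i * v j) * (u j * v i)) := by rw [h3]; ring
        _ = _ := by rw [h4]; ring
    have h6 : v ⬝ᵥ v * (u i * u j) ^ 2 ≤ 0 := by
      rw [h5]
      exact neg_nonpos.2 (by positivity)
    have h7 : (u i * u j) ^ 2 ≤ 0 := nonpos_of_mul_nonpos_right h6 hvv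
    exact pow_eq_zero_iff two_ne_zero |>.1 (le_antisymm h7 (sq_nonneg _))
  -- Every term of the quadratic form lies on an edge, whereas its value is `μ * (u ⬝ᵥ u)`.
  have hquad : u ⬝ᵥ M *ᵥ u = 0 := by
    simp only [dotProduct, Matrix.mulVec, Finset.mul_sum]
    refine Finset.sum_eq_zero fun i _ => Finset.sum_eq_zero fun j _ => ?_
    by_cases hij : adj i j
    · linear_combination M i j * key i j hij
    · simp [hM.2 i j hij]
  rw [← dotProduct_principalPart_mulVec hu0 hu0, hu, dotProduct_smul, smul_eq_mul] at hquad
  exact mul_ne_zero hμ huu.ne' hquad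

/-- Generically, an eigenvector of a principal submatrix for a nonzero eigenvalue can be orthogonal
to another row of the matrix only if its support avoids the pattern of that row. -/
lemma eigenvector_apply_eq_zero_of_adj (hadj : ∀ i j, adj i j → adj j i)
    {M : Matrix V V ℝ} (hM : M ∈ symmPattern adj) {Y : Finset V} {k : V} (hk : k ∉ Y)
    (hpow : ∀ N ∈ symmPattern adj,
      (powerMatrix (principalPart N Y)).rank ≤ (powerMatrix (principalPart M Y)).rank)
    (hkry : ∀ N ∈ symmPattern adj, (krylovMatrix (principalPart N Y) (N k)).rank ≤
      (krylovMatrix (principalPart M Y) (M k)).rank)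
    {μ : ℝ} (hμ : μ ≠ 0) {w : V → ℝ} (hw : principalPart M Y *ᵥ w = μ • w) (hwk : w ⬝ᵥ M k = 0)
    {i : V} (hi : adj k i) : w i = 0 := by
  by_contra hwi
  have hw0 : w ≠ 0 := fun h => hwi (by simp [h])
  have hiY : i ∈ Y := by
    by_contra hiY
    exact hwi (eq_zero_of_principalPart_mulVec hμ hw hiY)
  have hki : k ≠ i := by
    rintro rfl
    exact hk hiY
  have hT := principalPart_transpose hM Y
  set A := principalPart M Y
  obtain ⟨q, hqdeg, hqμ, hq⟩ := exists_separating_polynomial hT hw0 hw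
  have hwq : ∀ x : V → ℝ, w ⬝ᵥ Polynomial.aeval A q *ᵥ x = q.eval μ * (w ⬝ᵥ x) := by
    intro x
    have hsymm : (Polynomial.aeval A q)ᵀ = Polynomial.aeval A q := by
      rw [Polynomial.aeval_eq_sum_range, Matrix.transpose_sum]
      simp only [Matrix.transpose_smul, Matrix.transpose_pow, hT]
    rw [Matrix.dotProduct_mulVec, ← hsymm, Matrix.vecMul_transpose,
      aeval_mulVec_of_eigenvector hw, smul_dotProduct, smul_eq_mul]
  -- This vector lies in the `μ`-eigenspace and is orthogonal to `w`, so simplicity of `μ` kills it.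
  -- Hence `q` gives a right kernel vector of the Krylov matrix.
  have hy : Polynomial.aeval A q *ᵥ M k = 0 := by
    refine (eigenvalue_simple_of_rank_powerMatrix_max hadj hM hpow hμ hw ?_ ?_).resolve_left hw0
    · have : (A - algebraMap ℝ _ μ) *ᵥ Polynomial.aeval A q *ᵥ M k = 0 := by
        rw [map_mul, map_sub, Polynomial.aeval_X, Polynomial.aeval_C] at hq
        rw [Matrix.mulVec_mulVec, hq, Matrix.zero_mulVec]
      rw [Matrix.sub_mulVec, sub_eq_zero, Algebra.algebraMap_eq_smul_one, Matrix.smul_mulVec,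
        Matrix.one_mulVec] at this
      exact this
    · rw [hwq, hwk, mul_zero]
  have hqdeg' : q.natDegree < Fintype.card V + 1 := hqdeg.trans (Nat.lt_succ_self _)
  let F : ℝ → Matrix V (Fin (Fintype.card V + 1)) ℝ := fun t =>
    krylovMatrix A (M k + t • edgeMatrix k i k)
  have hrow : edgeMatrix k i k = Pi.single i 1 := by
    ext a
    simp [edgeMatrix, Matrix.single_apply, Pi.single_apply, hki.symm, eq_comm]
  -- Since `k ∉ Y`, perturbing the edge `k, i` changes row `k` but not the principal part.
  have hF : ∀ t : ℝ, F t = krylovMatrix (principalPart (M + t • edgeMatrix k i) Y)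
      ((M + t • edgeMatrix k i) k) := by
    intro t
    have hzero : principalPart (edgeMatrix k i) Y = 0 := by
      ext a b
      simp only [principalPart, edgeMatrix, Matrix.of_apply, Matrix.add_apply,
        Matrix.single_apply, Matrix.zero_apply, ite_eq_right_iff]
      rintro ⟨ha, hb⟩
      rw [if_neg (by rintro ⟨rfl, -⟩; exact hk ha), if_neg (by rintro ⟨-, rfl⟩; exact hk hb),
        add_zero]
    rw [principalPart_add_smul, hzero, smul_zero, add_zero]
    rfl
  have hgoal : q.eval μ * w i = 0 := by
    refine eq_zero_of_rank_le_rank_zero (F := F) ?_ ?_ (v := w) (u := fun l => q.coeff l) ?_ ?_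
      (g := fun _ => q.eval μ * w i) continuousAt_const ?_
    · intro a l
      simp only [F, krylovMatrix, Matrix.of_apply, Matrix.mulVec_add, Matrix.mulVec_smul]
      refine ⟨Polynomial.C ((A ^ (l : ℕ) *ᵥ M k) a) +
        Polynomial.C ((A ^ (l : ℕ) *ᵥ edgeMatrix k i k) a) * Polynomial.X, fun t => ?_⟩
      simp [mul_comm t]
    · intro t
      have h0 : F 0 = krylovMatrix A (M k) := by simp [F]
      rw [h0, hF]
      exact hkry _ (Submodule.add_mem _ hM
        (Submodule.smul_mem _ t (edgeMatrix_mem_symmPattern hadj hi)))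
    · ext l
      have h1 := aeval_mulVec_of_eigenvector hw (Polynomial.X ^ (l : ℕ))
      rw [map_pow, Polynomial.aeval_X] at h1
      have h2 : w ⬝ᵥ A ^ (l : ℕ) *ᵥ M k = 0 := by
        rw [Matrix.dotProduct_mulVec, ← hT, ← Matrix.transpose_pow, Matrix.vecMul_transpose, h1,
          smul_dotProduct, hwk, smul_zero]
      have h0 : F 0 = krylovMatrix A (M k) := by simp [F]
      rw [h0]
      exact h2
    · simp [F, krylovMatrix_mulVec_coeff _ _ hqdeg', hy]
    · intro t
      simp only [F]
      rw [krylovMatrix_mulVec_coeff _ _ hqdeg', Matrix.mulVec_add, hy, zero_add,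
        Matrix.mulVec_smul, dotProduct_smul, hwq, hrow, dotProduct_single, mul_one, smul_eq_mul]
  exact mul_ne_zero hqμ hwi hgoal

/-- The rows of a matrix in `S`, the others being replaced with zero. -/
def rowPart (M : Matrix V V ℝ) (S : Finset V) : Matrix V V ℝ :=
  Matrix.of fun i j => if i ∈ S then M i j else 0

lemma genericOn_rank_rowPart (L : Submodule ℝ (Matrix V V ℝ)) (S : Finset V) :
    GenericOn L fun M => ∀ N ∈ L, (rowPart N S).rank ≤ (rowPart M S).rank := by
  refine genericOn_rank_le L (F := fun M => rowPart M S) fun i j => ?_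
  by_cases h : i ∈ S
  · simpa [rowPart, h] using PolyOnLines.linear (Matrix.entryLinearMap ℝ ℝ i j)
  · simpa [rowPart, h] using PolyOnLines.const 0

/-- Generically, the rows in `S` of a symmetrically structured matrix satisfy no linear relation
with full support if `S` has at least as many neighbours as elements. -/
lemma eq_empty_of_vecMul_eq_zero (hadj : ∀ i j, adj i j → adj j i)
    {M : Matrix V V ℝ} (hM : M ∈ symmPattern adj) {S N : Finset V}
    (hN : ∀ j, j ∈ N ↔ ∃ i ∈ S, adj i j) (hcard : S.card ≤ N.card)
    (hrank : ∀ M' ∈ symmPattern adj, (rowPart M' S).rank ≤ (rowPart M S).rank)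
    {v : V → ℝ} (hv : ∀ i, i ∈ S ↔ v i ≠ 0) (hvM : v ᵥ* M = 0) : S = ∅ := by
  have hv0 : ∀ i, i ∉ S → v i = 0 := fun i hi => not_not.1 fun h => hi ((hv i).2 h)
  have hvrow : ∀ (B : Matrix V V ℝ), v ᵥ* rowPart B S = v ᵥ* B := by
    intro B
    ext j
    simp only [Matrix.vecMul, dotProduct]
    refine Finset.sum_congr rfl fun i _ => ?_
    by_cases hi : i ∈ S
    · simp [rowPart, hi]
    · simp [hv0 i hi]
  have hrow : ∀ (B : Matrix V V ℝ) (u : V → ℝ) (i : V),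
      (rowPart B S *ᵥ u) i = if i ∈ S then (B *ᵥ u) i else 0 := by
    intro B u i
    by_cases hi : i ∈ S <;> simp [Matrix.mulVec, dotProduct, rowPart, hi]
  -- `v` is in the left kernel of `rowPart M S`, so maximal rank forces the edge perturbation to
  -- pair to zero with every right kernel vector `u`.
  have tangent : ∀ u : V → ℝ, rowPart M S *ᵥ u = 0 → ∀ i j, adj i j → v i * u j + v j * u i = 0 := by
    intro u hu i j hij
    have hlin : ∀ t : ℝ, rowPart (M + t • edgeMatrix i j) S =
        rowPart M S + t • rowPart (edgeMatrix i j) S := by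
      intro t
      ext a b
      by_cases ha : a ∈ S <;> simp [rowPart, ha]
    refine eq_zero_of_rank_le_rank_zero
      (F := fun t : ℝ => rowPart (M + t • edgeMatrix i j) S) ?_ ?_ (v := v) (u := u) ?_ ?_
      (g := fun _ => v i * u j + v j * u i) continuousAt_const ?_
    · intro a b
      refine ⟨Polynomial.C (rowPart M S a b) +
        Polynomial.C (rowPart (edgeMatrix i j) S a b) * Polynomial.X, fun t => ?_⟩
      simp [hlin, mul_comm t]
    · intro t
      simpa using hrank _ (Submodule.add_mem _ hM
        (Submodule.smul_mem _ t (edgeMatrix_mem_symmPattern hadj hij)))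
    · simp [hvrow, hvM]
    · simp [hu]
    · intro t
      rw [hlin, Matrix.dotProduct_mulVec, Matrix.vecMul_add, Matrix.vecMul_smul, hvrow, hvrow, hvM,
        zero_add, smul_dotProduct, ← Matrix.dotProduct_mulVec, dotProduct_edgeMatrix_mulVec,
        smul_eq_mul]
  have hMT : Mᵀ = M := by
    ext i j
    exact hM.1 j i
  have hvker : rowPart M S *ᵥ v = 0 := by
    have : M *ᵥ v = 0 := by rw [← Matrix.vecMul_transpose, hMT, hvM]
    ext i
    simp [hrow, this]
  -- By symmetry `v` is itself a right kernel vector, so `tangent` yields `2 * v i * v j = 0` on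
  -- edges.
  have hvN : ∀ j ∈ N, v j = 0 := by
    intro j hj
    obtain ⟨i, hi, hij⟩ := (hN j).1 hj
    have := tangent v hvker i j hij
    have h2 : v i * v j = 0 := by linarith
    exact (mul_eq_zero.1 h2).resolve_left ((hv i).1 hi)
  have hker : ∀ u : V → ℝ, rowPart M S *ᵥ u = 0 → ∀ j ∈ N, u j = 0 := by
    intro u hu j hj
    obtain ⟨i, hi, hij⟩ := (hN j).1 hj
    have := tangent u hu i j hij
    rw [hvN j hj, zero_mul, add_zero] at this
    exact (mul_eq_zero.1 this).resolve_left ((hv i).1 hi)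
  -- All right kernel vectors vanish on `N`, so this block is injective; with `|S| ≤ |N|` it is
  -- square and invertible, yet `v` restricted to `S` is in its left kernel.
  let B : Matrix S N ℝ := M.submatrix Subtype.val Subtype.val
  have hinj : Function.Injective B.mulVecLin := by
    rw [injective_iff_map_eq_zero]
    intro x hx
    let u : V → ℝ := fun j => if h : j ∈ N then x ⟨j, h⟩ else 0
    have hu : rowPart M S *ᵥ u = 0 := by
      ext i
      rw [hrow]
      by_cases hi : i ∈ S
      · have h1 := congrFun hx ⟨i, hi⟩
        simp only [Matrix.mulVecLin_apply, Matrix.mulVec, dotProduct, B, Matrix.submatrix_apply,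
          Pi.zero_apply] at h1
        simp only [hi, if_true, Matrix.mulVec, dotProduct, Pi.zero_apply]
        rw [← h1, ← Finset.sum_subset (Finset.subset_univ N) fun j _ hj => by simp [u, hj],
          ← Finset.sum_coe_sort N]
        exact Finset.sum_congr rfl fun j _ => by simp [u]
      · simp [hi]
    ext j
    have := hker u hu j j.2
    simpa [u] using this
  have hle := LinearMap.finrank_le_finrank_of_injective hinj
  simp only [Module.finrank_fintype_fun_eq_card, Fintype.card_coe] at hle
  have hsurj : Function.Surjective B.mulVecLin :=
    (LinearMap.injective_iff_surjective_of_finrank_eq_finrank (by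
      simp [le_antisymm hle hcard])).1 hinj
  by_contra hne
  obtain ⟨i, hi⟩ := Finset.nonempty_of_ne_empty hne
  obtain ⟨x, hx⟩ := hsurj (Pi.single ⟨i, hi⟩ 1)
  have hvB : (fun i : S => v i) ᵥ* B = 0 := by
    ext j
    have h1 := congrFun hvM j
    simp only [Matrix.vecMul, dotProduct, Pi.zero_apply, B, Matrix.submatrix_apply] at h1 ⊢
    rw [← h1, ← Finset.sum_subset (Finset.subset_univ S) fun i _ hi => by simp [hv0 i hi],
      ← Finset.sum_coe_sort S]
  have h1 : (fun i : S => v i) ⬝ᵥ B *ᵥ x = v i := by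
    rw [Matrix.mulVecLin_apply] at hx
    rw [hx, dotProduct_single, mul_one]
  rw [Matrix.dotProduct_mulVec, hvB, zero_dotProduct] at h1
  exact (hv i).1 hi h1.symm

end GenericSpectrum

/-! ### Choice of the generic matrix, invariant subspaces, full row rank -/

lemma exists_generic_symmPattern {V : Type*} [Fintype V] [DecidableEq V] (adj : V → V → Prop) :
    ∃ M ∈ symmPattern adj,
      (∀ Y : Finset V, ∀ N ∈ symmPattern adj,
        (powerMatrix (principalPart N Y)).rank ≤ (powerMatrix (principalPart M Y)).rank) ∧
      (∀ (Y : Finset V) (k : V), ∀ N ∈ symmPattern adj,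
        (krylovMatrix (principalPart N Y) (N k)).rank ≤
          (krylovMatrix (principalPart M Y) (M k)).rank) ∧
      ∀ S : Finset V, ∀ N ∈ symmPattern adj, (rowPart N S).rank ≤ (rowPart M S).rank :=
  ((GenericOn.fintype_forall fun Y => genericOn_rank_powerMatrix _ Y).and
    ((GenericOn.fintype_forall fun Y => GenericOn.fintype_forall fun k =>
      genericOn_rank_krylovMatrix _ Y k).and
    (GenericOn.fintype_forall fun S => genericOn_rank_rowPart _ S))).exists_mem

/-- A symmetric matrix vanishes on an invariant subspace without eigenvectors for nonzero
eigenvalues. -/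
lemma mulVec_eq_zero_of_invariant {ι : Type*} [Fintype ι] [DecidableEq ι] {A : Matrix ι ι ℝ}
    (hA : Aᵀ = A) (W : Submodule ℝ (ι → ℝ)) (hW : ∀ w ∈ W, A *ᵥ w ∈ W)
    (hev : ∀ z ∈ W, ∀ μ : ℝ, μ ≠ 0 → A *ᵥ z = μ • z → z = 0) {w : ι → ℝ} (hw : w ∈ W) :
    A *ᵥ w = 0 := by
  have key : ∀ s : Finset ℝ, 0 ∉ s → ∀ y ∈ W,
      Polynomial.aeval A (∏ μ ∈ s, (Polynomial.X - Polynomial.C μ)) *ᵥ y = 0 → y = 0 := by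
    intro s
    induction s using Finset.induction_on with
    | empty => simp
    | insert a s ha ih =>
      intro h0 y hy hy0
      rw [Finset.mem_insert, not_or] at h0
      rw [Finset.prod_insert ha, mul_comm, map_mul, ← Matrix.mulVec_mulVec, map_sub,
        Polynomial.aeval_X, Polynomial.aeval_C, Algebra.algebraMap_eq_smul_one, Matrix.sub_mulVec,
        Matrix.smul_mulVec, Matrix.one_mulVec] at hy0
      exact hev y hy a (Ne.symm h0.1)
        (sub_eq_zero.1 (ih h0.2 _ (W.sub_mem (hW y hy) (W.smul_mem a hy)) hy0))
  obtain ⟨s, -, hs⟩ := exists_aeval_prod_eq_zero hA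
  -- The factor for the eigenvalue `0` is supplied by `A` itself in `A *ᵥ w`; the remaining factors
  -- are invertible on `W`.
  refine key (s.erase 0) (by simp) _ (hW w hw) ?_
  have hX : Polynomial.aeval A
      ((∏ μ ∈ s.erase 0, (Polynomial.X - Polynomial.C μ)) * Polynomial.X) = 0 := by
    by_cases h0 : (0 : ℝ) ∈ s
    · rw [← Finset.mul_prod_erase s _ h0, mul_comm] at hs
      simpa using hs
    · rw [Finset.erase_eq_of_notMem h0, map_mul, hs, zero_mul]
  rw [map_mul, Polynomial.aeval_X] at hX
  rw [Matrix.mulVec_mulVec, hX, Matrix.zero_mulVec]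

/-- Cayley–Hamilton: each power of `A` is a combination of the first `n`. -/
lemma vecMul_pow_mul_eq_zero {n m : ℕ} {A : Matrix (Fin n) (Fin n) ℝ}
    {B : Matrix (Fin n) (Fin m) ℝ} {w : Fin n → ℝ} (h : ∀ l < n, w ᵥ* (A ^ l * B) = 0) (l : ℕ) :
    w ᵥ* (A ^ l * B) = 0 := by
  rcases Nat.eq_zero_or_pos n with rfl | hn
  · rw [Subsingleton.elim w 0, Matrix.zero_vecMul]
  have hdeg : (Polynomial.X ^ l %ₘ A.charpoly).natDegree < n := by
    have h1 := Polynomial.natDegree_modByMonic_lt (Polynomial.X ^ l) A.charpoly_monic (by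
      intro h1
      have := A.charpoly_natDegree_eq_dim
      rw [h1, Polynomial.natDegree_one, Fintype.card_fin] at this
      omega)
    rwa [A.charpoly_natDegree_eq_dim, Fintype.card_fin] at h1
  rw [Matrix.pow_eq_aeval_mod_charpoly, Polynomial.aeval_eq_sum_range' hdeg, Matrix.sum_mul,
    Matrix.vecMul_sum]
  refine Finset.sum_eq_zero fun k hk => ?_
  rw [Matrix.smul_mul, Matrix.vecMul_smul, h k (Finset.mem_range.1 hk), smul_zero]

lemma Matrix.rank_eq_card_iff_vecMul {α β : Type*} [Fintype α] [Fintype β] {F : Matrix α β ℝ} :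
    F.rank = Fintype.card α ↔ ∀ v : α → ℝ, v ᵥ* F = 0 → v = 0 := by
  have h1 : F.rank = Fintype.card α ↔ LinearIndependent ℝ F.row := by
    rw [linearIndependent_iff_card_eq_finrank_span, Matrix.rank_eq_finrank_span_row, eq_comm]
    rfl
  rw [h1, ← Matrix.vecMul_injective_iff]
  exact injective_iff_map_eq_zero F.vecMulLinear

lemma targetControllabilityMatrix_apply {n m : ℕ} (A : Matrix (Fin n) (Fin n) ℝ)
    (B : Matrix (Fin n) (Fin m) ℝ) (T : Finset (Fin n)) (i : T) (c : Fin n × Fin m) :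
    targetControllabilityMatrix A B T i c = (A ^ (c.1 : ℕ) * B) i c.2 := by
  simp [targetControllabilityMatrix, targetMatrix, controllabilityMatrix, Matrix.mul_apply]

/-! ### Reachability, necessity and sufficiency -/

section SystemDigraph

variable {n m : ℕ} {A : StructuredMatrix n n} {B : StructuredMatrix n m}

lemma inputReachable_inr (j : Fin m) : InputReachable A B (Sum.inr j) :=
  ⟨j, [Sum.inr j], by simp [Digraph.IsPathFromTo]⟩

/-- Paths have distinct vertices, so if `w` already occurs the path is cut there instead of
extended. -/
lemma InputReachable.step {v w : Fin n ⊕ Fin m} (hv : InputReachable A B v)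
    (h : (systemDigraph A B).Adj v w) : InputReachable A B w := by
  obtain ⟨j, p, hnd, hch, hhead, hlast⟩ := hv
  by_cases hw : w ∈ p
  · obtain ⟨l₁, l₂, rfl⟩ := List.append_of_mem hw
    have hpre : l₁ ++ [w] <+: l₁ ++ w :: l₂ := ⟨l₂, by simp⟩
    refine ⟨j, l₁ ++ [w], hnd.sublist hpre.sublist, hch.prefix hpre, ?_, by simp⟩
    rw [← hhead]
    cases l₁ <;> simp
  · refine ⟨j, p ++ [w], ?_, ?_, ?_, by simp⟩
    · rw [List.nodup_append]
      exact ⟨hnd, by simp, by rintro a ha b hb rfl; simp at hb; exact hw (hb ▸ ha)⟩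
    · rw [List.isChain_append]
      refine ⟨hch, by simp, ?_⟩
      intro x hx y hy
      rw [hlast] at hx
      simp only [List.head?_cons, Option.mem_def, Option.some.injEq] at hx hy
      subst hx hy
      exact h
    · rw [List.head?_append, hhead]
      rfl

lemma InputReachable.induction {Q : Fin n ⊕ Fin m → Prop} (h0 : ∀ j, Q (Sum.inr j))
    (hstep : ∀ v w, Q v → (systemDigraph A B).Adj v w → Q w) {v : Fin n ⊕ Fin m}
    (hv : InputReachable A B v) : Q v := by
  obtain ⟨j, p, -, hch, hhead, hlast⟩ := hv
  have key : ∀ (p : List (Fin n ⊕ Fin m)) (a b : Fin n ⊕ Fin m), Q a →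
      p.IsChain (systemDigraph A B).Adj → p.head? = some a → p.getLast? = some b → Q b := by
    intro p
    induction p with
    | nil => simp
    | cons x p ih =>
      intro a b ha hch hhead hlast
      obtain rfl : x = a := by simpa using hhead
      cases p with
      | nil =>
        obtain rfl : x = b := by simpa using hlast
        exact ha
      | cons y p =>
        rw [List.isChain_cons_cons] at hch
        exact ih y b (hstep x y ha hch.1) hch.2 rfl (by simpa using hlast)
  exact key p _ v (h0 j) hch hhead hlast

lemma inputReachable_of_pow_mul_apply_ne_zero {RA : Matrix (Fin n) (Fin n) ℝ}
    {RB : Matrix (Fin n) (Fin m) ℝ} (hRA : A.IsRealization RA) (hRB : B.IsRealization RB) (l : ℕ)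
    {i : Fin n} {j : Fin m} (h : (RA ^ l * RB) i j ≠ 0) : InputReachable A B (Sum.inl i) := by
  induction l generalizing i with
  | zero =>
    rw [pow_zero, Matrix.one_mul] at h
    refine (inputReachable_inr j).step ?_
    change B i j = StructEntry.star
    cases hB : B i j with
    | zero => exact absurd (hRB i j hB) h
    | star => rfl
  | succ l ih =>
    rw [pow_succ', Matrix.mul_assoc, Matrix.mul_apply] at h
    obtain ⟨k, -, hk⟩ := Finset.exists_ne_zero_of_sum_ne_zero h
    refine (ih (right_ne_zero_of_mul hk)).step ?_
    change A i k = StructEntry.star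
    cases hA : A i k with
    | zero => exact absurd (hRA i k hA) (left_ne_zero_of_mul hk)
    | star => rfl

lemma inputReachable_of_rank_eq_card {RA : Matrix (Fin n) (Fin n) ℝ}
    {RB : Matrix (Fin n) (Fin m) ℝ} (hRA : A.IsRealization RA) (hRB : B.IsRealization RB)
    {T : Finset (Fin n)} (hrank : (targetControllabilityMatrix RA RB T).rank = T.card)
    {i : Fin n} (hi : i ∈ T) : InputReachable A B (Sum.inl i) := by
  classical
  rw [← Fintype.card_coe, Matrix.rank_eq_card_iff_vecMul] at hrank
  by_contra hcon
  have := hrank (Pi.single ⟨i, hi⟩ 1) (by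
    ext c
    rw [Matrix.single_one_vecMul, Matrix.row_apply, targetControllabilityMatrix_apply]
    by_contra h
    exact hcon (inputReachable_of_pow_mul_apply_ne_zero hRA hRB _ h))
  simpa using congrFun this ⟨i, hi⟩

lemma card_le_ncard_inNeighbourSet {RA : Matrix (Fin n) (Fin n) ℝ}
    {RB : Matrix (Fin n) (Fin m) ℝ} (hRA : A.IsRealization RA) (hRB : B.IsRealization RB)
    {T : Finset (Fin n)} (hrank : (targetControllabilityMatrix RA RB T).rank = T.card)
    {S : Finset (Fin n)} (hS : S ⊆ T) :
    S.card ≤ ((systemDigraph A B).inNeighbourSet (Sum.inl '' (S : Set (Fin n)))).ncard := by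
  classical
  rw [← Fintype.card_coe T, Matrix.rank_eq_card_iff_vecMul] at hrank
  by_contra! hlt
  set N := (systemDigraph A B).inNeighbourSet (Sum.inl '' (S : Set (Fin n)))
  let C : Matrix (Fin n) (Fin n ⊕ Fin m) ℝ := Matrix.fromCols RA RB
  let f : (S → ℝ) →ₗ[ℝ] (N → ℝ) :=
    (Matrix.of fun (i : S) (c : N) => C i c).vecMulLinear
  have hker : LinearMap.ker f ≠ ⊥ := by
    -- Only columns in `N` can be nonzero on rows in `S`, and there are fewer of them than rows.
    refine LinearMap.ker_ne_bot_of_finrank_lt ?_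
    rwa [Module.finrank_fintype_fun_eq_card, Module.finrank_fintype_fun_eq_card, Fintype.card_coe,
      ← Nat.card_eq_fintype_card, Nat.card_coe_set_eq]
  obtain ⟨x, hx, hx0⟩ := Submodule.exists_mem_ne_zero_of_ne_bot hker
  let w : Fin n → ℝ := fun i => if h : i ∈ S then x ⟨i, h⟩ else 0
  have hwS : ∀ g : Fin n → ℝ, ∑ i, w i * g i = ∑ i : S, x i * g i := by
    intro g
    rw [← Finset.sum_subset (Finset.subset_univ S) fun i _ hi => by simp [w, hi],
      ← Finset.sum_coe_sort S]
    exact Finset.sum_congr rfl fun i _ => by simp [w]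
  have hwC : w ᵥ* C = 0 := by
    ext c
    simp only [Matrix.vecMul, dotProduct, Pi.zero_apply]
    rw [hwS]
    by_cases hc : c ∈ N
    · exact congrFun (LinearMap.mem_ker.1 hx) ⟨c, hc⟩
    · refine Finset.sum_eq_zero fun i _ => ?_
      have hnot : ¬ (systemDigraph A B).Adj c (Sum.inl i) := fun hadj =>
        hc ⟨Sum.inl i, ⟨i, i.2, rfl⟩, hadj⟩
      have : C i c = 0 := by
        rcases c with k | k
        · refine hRA i k ?_
          cases h : A i k with
          | zero => rfl
          | star => exact absurd h hnot
        · refine hRB i k ?_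
          cases h : B i k with
          | zero => rfl
          | star => exact absurd h hnot
      rw [this, mul_zero]
  rw [Matrix.vecMul_fromCols] at hwC
  have hwA : w ᵥ* RA = 0 := funext fun i => congrFun hwC (Sum.inl i)
  have hwB : w ᵥ* RB = 0 := funext fun i => congrFun hwC (Sum.inr i)
  have hwT := hrank (fun i => w i) (by
    ext c
    have h1 : (w ᵥ* (RA ^ (c.1 : ℕ) * RB)) c.2 = 0 := by
      rw [← Matrix.vecMul_vecMul]
      cases (c.1 : ℕ) with
      | zero => simp [hwB]
      | succ l => simp [pow_succ', ← Matrix.vecMul_vecMul, hwA]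
    simp only [Matrix.vecMul, dotProduct, targetControllabilityMatrix_apply, Pi.zero_apply] at h1 ⊢
    rw [← h1, ← Finset.sum_subset (Finset.subset_univ T) fun i _ hi => by
      simp [w, show i ∉ S from fun h => hi (hS h)], ← Finset.sum_coe_sort T])
  refine hx0 (funext fun i => ?_)
  have := congrFun hwT ⟨i, hS i.2⟩
  simpa [w] using this

/-- Generic realizations have no uncontrollable mode with nonzero eigenvalue that is supported on
the input-reachable states. -/
lemma eigenvector_eq_zero_of_generic {adj : Fin n ⊕ Fin m → Fin n ⊕ Fin m → Prop}
    (hadj : ∀ v w, adj v w → adj w v) (hle : ∀ v w, (systemDigraph A B).Adj v w → adj v w)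
    {M : Matrix (Fin n ⊕ Fin m) (Fin n ⊕ Fin m) ℝ} (hM : M ∈ symmPattern adj)
    (hpow : ∀ Y : Finset (Fin n ⊕ Fin m), ∀ N ∈ symmPattern adj,
      (powerMatrix (principalPart N Y)).rank ≤ (powerMatrix (principalPart M Y)).rank)
    (hkry : ∀ (Y : Finset (Fin n ⊕ Fin m)) (k : Fin n ⊕ Fin m), ∀ N ∈ symmPattern adj,
      (krylovMatrix (principalPart N Y) (N k)).rank ≤
        (krylovMatrix (principalPart M Y) (M k)).rank)
    {z : Fin n → ℝ} (hz : ∀ i, z i ≠ 0 → InputReachable A B (Sum.inl i))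
    (hzB : z ᵥ* M.toBlocks₁₂ = 0) {μ : ℝ} (hμ : μ ≠ 0) (hev : M.toBlocks₁₁ *ᵥ z = μ • z) :
    z = 0 := by
  classical
  let y : Fin n ⊕ Fin m → ℝ := Sum.elim z 0
  let X : Finset (Fin n ⊕ Fin m) := Finset.univ.map Function.Embedding.inl
  have hXl : ∀ i, Sum.inl i ∈ X := fun i => by simp [X]
  have hXr : ∀ j, Sum.inr j ∉ X := fun j => by simp [X]
  have hsum : ∀ g : Fin n ⊕ Fin m → ℝ, ∑ c, g c * y c = ∑ i, g (Sum.inl i) * z i := by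
    intro g
    simp [y, Fintype.sum_sum_type]
  have hyX : principalPart M X *ᵥ y = μ • y := by
    ext c
    simp only [Matrix.mulVec, dotProduct]
    rw [hsum]
    rcases c with i | j
    · simpa [principalPart, hXl, y] using! congrFun hev i
    · simp [principalPart, hXr, y]
  -- At a state `k` with `y k = 0`, deleting `k` keeps `y` an eigenvector, and the deleted equation
  -- says that `y` is orthogonal to row `k`. At an input the orthogonality is `hzB`. Either way `y`
  -- vanishes at all neighbours.
  have hreach : ∀ v, InputReachable A B v → y v = 0 := by
    intro v hv
    refine hv.induction (Q := fun v => y v = 0) (fun j => rfl) fun v w hyv hvw => ?_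
    have hvw' := hle v w hvw
    rcases v with k | j
    · refine eigenvector_apply_eq_zero_of_adj hadj hM (Y := X.erase (Sum.inl k)) (k := Sum.inl k)
        (by simp) (hpow _) (hkry _ _) hμ ?_ ?_ hvw'
      · ext c
        by_cases hc : c = Sum.inl k
        · subst hc
          simp [Matrix.mulVec, dotProduct, principalPart, hyv]
        · rw [← hyX]
          simp only [Matrix.mulVec, dotProduct]
          refine Finset.sum_congr rfl fun d _ => ?_
          by_cases hd : d = Sum.inl k
          · simp [hd, hyv]
          · simp [principalPart, hc, hd]
      · have h1 := congrFun hev k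
        have hzk : z k = 0 := hyv
        rw [Pi.smul_apply, hzk, smul_zero] at h1
        rw [dotProduct_comm, ← h1]
        exact hsum _
    · refine eigenvector_apply_eq_zero_of_adj hadj hM (Y := X) (k := Sum.inr j) (hXr j) (hpow _)
        (hkry _ _) hμ hyX ?_ hvw'
      have h1 := congrFun hzB j
      rw [dotProduct_comm]
      refine (hsum _).trans (Eq.trans ?_ h1)
      refine Finset.sum_congr rfl fun i _ => ?_
      rw [hM.1 (Sum.inr j), mul_comm]
      rfl
  ext i
  by_contra hi
  exact hi (hreach _ (hz i hi))

lemma structurallyTargetControllable_of_inputReachable (hA : A.IsSymmetricallyStructured)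
    {T : Finset (Fin n)} (hreach : ∀ i ∈ T, InputReachable A B (Sum.inl i))
    (hcard : ∀ S : Set (Fin n ⊕ Fin m), S ⊆ targetVertices m T →
      S.ncard ≤ ((systemDigraph A B).inNeighbourSet S).ncard) :
    StructurallyTargetControllable A B T := by
  classical
  let adj : Fin n ⊕ Fin m → Fin n ⊕ Fin m → Prop := fun v w =>
    (systemDigraph A B).Adj v w ∨ (systemDigraph A B).Adj w v
  have hadj : ∀ v w, adj v w → adj w v := fun v w h => h.symm
  -- Symmetry of `A` and the absence of edges into inputs make the symmetrized neighbours of a state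
  -- exactly its in-neighbours, so `M` respects the patterns and the cardinality condition
  -- transfers.
  have hflip : ∀ v i, adj (Sum.inl i) v → (systemDigraph A B).Adj v (Sum.inl i) := by
    rintro (k | j) i (h | h)
    · exact (hA i k).trans h
    · exact h
    · exact h.elim
    · exact h
  obtain ⟨M, hM, hpow, hkry, hrow⟩ := exists_generic_symmPattern adj
  set RA := M.toBlocks₁₁
  set RB := M.toBlocks₁₂
  have hRAT : RAᵀ = RA := by
    ext i j
    exact hM.1 _ _
  have hRA : A.IsRealization RA := by
    intro i k h
    refine hM.2 _ _ fun had => ?_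
    have : A i k = StructEntry.star := hflip _ _ had
    simp [h] at this
  have hRB : B.IsRealization RB := by
    intro i j h
    refine hM.2 _ _ fun had => ?_
    have : B i j = StructEntry.star := hflip _ _ had
    simp [h] at this
  refine ⟨RA, RB, ⟨hRA, fun i j => hM.1 _ _⟩, hRB, ?_⟩
  rw [← Fintype.card_coe, Matrix.rank_eq_card_iff_vecMul]
  intro x hx
  let w : Fin n → ℝ := fun i => if h : i ∈ T then x ⟨i, h⟩ else 0
  have hwT : ∀ i, w i ≠ 0 → i ∈ T := by
    intro i hi
    by_contra h
    exact hi (by simp [w, h])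
  -- The restriction to reachable states is needed because an unreachable component may carry
  -- uncontrollable eigenvectors; edges lead from reachable states only to reachable ones, so `W`
  -- stays invariant.
  let W : Submodule ℝ (Fin n → ℝ) :=
    { carrier := {z | (∀ i, ¬ InputReachable A B (Sum.inl i) → z i = 0) ∧
        ∀ l : ℕ, z ᵥ* (RA ^ l * RB) = 0}
      add_mem' := fun {a b} ha hb => ⟨fun i hi => by simp [ha.1 i hi, hb.1 i hi],
        fun l => by rw [Matrix.add_vecMul, ha.2, hb.2, add_zero]⟩
      zero_mem' := ⟨fun _ _ => rfl, fun l => by simp⟩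
      smul_mem' := fun c a ha => ⟨fun i hi => by simp [ha.1 i hi],
        fun l => by rw [Matrix.smul_vecMul, ha.2, smul_zero]⟩ }
  have hwW : w ∈ W := by
    refine ⟨fun i hi => not_not.1 fun h => hi (hreach i (hwT i h)), fun l =>
      vecMul_pow_mul_eq_zero (fun l hl => ?_) l⟩
    ext j
    have h1 := congrFun hx (⟨l, hl⟩, j)
    simp only [Matrix.vecMul, dotProduct, targetControllabilityMatrix_apply, Pi.zero_apply] at h1 ⊢
    rw [← h1, ← Finset.sum_subset (Finset.subset_univ T) fun i _ hi => by simp [w, hi],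
      ← Finset.sum_coe_sort T]
    exact Finset.sum_congr rfl fun i _ => by simp [w]
  have hWinv : ∀ z ∈ W, RA *ᵥ z ∈ W := by
    intro z hz
    refine ⟨fun i hi => ?_, fun l => ?_⟩
    · by_contra h
      obtain ⟨k, -, hk⟩ := Finset.exists_ne_zero_of_sum_ne_zero (s := Finset.univ)
        (f := fun k => RA i k * z k) h
      have hzk : InputReachable A B (Sum.inl k) :=
        not_not.1 fun h' => right_ne_zero_of_mul hk (hz.1 k h')
      refine hi (hzk.step ?_)
      change A i k = StructEntry.star
      cases hAik : A i k with
      | zero => exact absurd (hRA i k hAik) (left_ne_zero_of_mul hk)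
      | star => rfl
    · rw [← Matrix.vecMul_transpose, hRAT, Matrix.vecMul_vecMul, ← Matrix.mul_assoc, ← pow_succ']
      exact hz.2 (l + 1)
  have hwA : RA *ᵥ w = 0 := by
    refine mulVec_eq_zero_of_invariant hRAT W hWinv (fun z hz μ hμ hev => ?_) hwW
    refine eigenvector_eq_zero_of_generic hadj (fun v w h => Or.inl h) hM hpow hkry
      (fun i hi => not_not.1 fun h => hi (hz.1 i h)) ?_ hμ hev
    simpa using hz.2 0
  have hwB : w ᵥ* RB = 0 := by simpa using hwW.2 0
  let v : Fin n ⊕ Fin m → ℝ := Sum.elim w 0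
  have hvM : v ᵥ* M = 0 := by
    rw [← Matrix.vecMul_transpose, hRAT] at hwA
    rw [← M.fromBlocks_toBlocks, Matrix.vecMul_fromBlocks]
    ext (i | j)
    · simpa [v] using congrFun hwA i
    · simpa [v] using congrFun hwB j
  let S : Finset (Fin n ⊕ Fin m) := Finset.univ.filter fun c => v c ≠ 0
  let N : Finset (Fin n ⊕ Fin m) := Finset.univ.filter fun c => ∃ i ∈ S, adj i c
  have hST : (S : Set (Fin n ⊕ Fin m)) ⊆ targetVertices m T := by
    rintro (i | j) hc
    · exact ⟨i, hwT i (by simpa [S, v] using hc), rfl⟩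
    · simp [S, v] at hc
  have hN : (systemDigraph A B).inNeighbourSet (S : Set (Fin n ⊕ Fin m)) = N := by
    ext c
    constructor
    · rintro ⟨s, hs, hcs⟩
      exact Finset.mem_coe.2 (Finset.mem_filter.2 ⟨Finset.mem_univ c, s, hs, Or.inr hcs⟩)
    · intro hc
      obtain ⟨s, hs, hsc⟩ : ∃ i ∈ S, adj i c := (Finset.mem_filter.1 hc).2
      obtain ⟨i, -, rfl⟩ := hST hs
      exact ⟨_, hs, hflip _ _ hsc⟩
  have hSN : S.card ≤ N.card := by
    have := hcard S hST
    rwa [hN, Set.ncard_coe_finset, Set.ncard_coe_finset] at this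
  have hS : S = ∅ := eq_empty_of_vecMul_eq_zero hadj hM (N := N) (by simp [N]) hSN (hrow S)
    (by simp [S]) hvM
  ext i
  have : Sum.inl (i : Fin n) ∉ S := by simp [hS]
  simpa [S, v, w] using this

end SystemDigraph

theorem mainTheorem1 {n m : ℕ} (A : StructuredMatrix n n) (B : StructuredMatrix n m)
    (hA : A.IsSymmetricallyStructured) (T : Finset (Fin n)) :
    StructurallyTargetControllable A B T ↔
      (∀ v ∈ targetVertices m T, InputReachable A B v) ∧
      (∀ S : Set (Fin n ⊕ Fin m), S ⊆ targetVertices m T →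
        S.ncard ≤ ((systemDigraph A B).inNeighbourSet S).ncard) := by
  classical
  constructor
  · rintro ⟨RA, RB, ⟨hRA, -⟩, hRB, hrank⟩
    refine ⟨?_, fun S hS => ?_⟩
    · rintro _ ⟨i, hi, rfl⟩
      exact inputReachable_of_rank_eq_card hRA hRB hrank hi
    · let S' : Finset (Fin n) := T.filter fun i => Sum.inl i ∈ S
      have hSS' : S = Sum.inl '' (S' : Set (Fin n)) := by
        ext c
        constructor
        · intro hc
          obtain ⟨i, hi, rfl⟩ := hS hc
          exact ⟨i, by simp [S', hi, hc], rfl⟩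
        · rintro ⟨i, hi, rfl⟩
          have : i ∈ S' := hi
          exact (Finset.mem_filter.1 this).2
      have := card_le_ncard_inNeighbourSet hRA hRB hrank (S := S') (Finset.filter_subset _ _)
      rwa [← hSS', ← Set.ncard_coe_finset,
        ← Set.ncard_image_of_injective (S' : Set (Fin n)) Sum.inl_injective, ← hSS'] at this
  · rintro ⟨h1, h2⟩
    exact structurallyTargetControllable_of_inputReachable hA
      (fun i hi => h1 _ ⟨i, hi, rfl⟩) h2
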